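/- Let $m,n\ge 0$, write $[m+n]=\{1,\dots,m+n\}$, and let $\bar i=0$ for $i\le m$ and $\bar i=1$ for $i>m$. Let $A(\mathrm{Mat}_{m|n})$ be the coordinate superalgebra of $(m|n)\times(m|n)$ supermatrices, i.e. the free supercommutative $\mathbb C$-algebra on generators $x_{ij}$ ($1\le i,j\le m+n$) of parity $\bar i+\bar j$, and let $X=(x_{ij})$ be the generator supermatrix. Let $e_1,\dots,e_{m+n}$ be the standard basis of $\mathbb C^{m|n}$, with $e_i$ of parity $\bar i$, and let $X_a=\sum_{i,j}x_{ij}\otimes 1^{\otimes(a-1)}\otimes e_{ij}\otimes 1^{\otimes(r-a)}$ act on $A(\mathrm{Mat}_{m|n})\otimes(\mathbb C^{m|n})^{\otimes r}$ with the usual sign rule. Let $\mathfrak S_r$ act on $(\mathbb C^{m|n})^{\otimes r}$ by $$\sigma\cdot e_{i_1}\otimes\cdots\otimes e_{i_r}=(-1)^{\sum_{k<l,\ \sigma(k)>\sigma(l)}\bar i_k\bar i_l}\,e_{i_{\sigma^{-1}(1)}}\otimes\cdots\otimes e_{i_{\sigma^{-1}(r)}} .$$ For a character $\chi$ of $\mathfrak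 S_r$, identified with the element $\sum_{\sigma}\chi(\sigma)\sigma$ of the group algebra, and for $I=(i_1,\dots,i_r)\in[m+n]^r$, the super-immanant of the generalized submatrix $X_I$ (rows and columns indexed by $I$) is $$\mathrm{Imm}_\chi(X_I)=(-1)^{\bar i_1+\cdots+\bar i_r}\langle i_1,\dots,i_r\mid \chi\,X_1\cdots X_r\mid i_1,\dots,i_r\rangle ,$$ where $|i_1,\dots,i_r\rangle=e_{i_1}\otimes\cdots\otimes e_{i_r}$ and $\langle i_1,\dots,i_r|$ is the dual functional (extended by the sign rule). Put $\alpha(I)=\alpha_1!\cdots\alpha_{m+n}!$, where $\alpha_i$ is the multiplicity of $i$ in $I$. Let $\chi^\mu$ be the irreducible character of $\mathfrak S_r$ indexed by the partition $\mu\vdash r$. Let $I=(i_1\le\cdots\le i_k)$ be a non-decreasing multiset of elements of $[m+n]$, and let $\lambda=(\lambda_1\ge\dots\ge\lambda_l\ge 0)$ be a partition of $k$. Let $\psi^\lambda$ (resp. $\phi^\lambda$) be the character of $\mathfrak S_k$ induced from the sign (resp. trivial) character of the Young subgroup $\mathfrak S_{\lambda_1}\times\cdots\times\mathfrak S_{\lambda_l}$.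 Then $$\mathrm{Imm}_{\psi^\lambda}(X_I)=\sum_{(I_1,\dots,I_l)}\frac{\alpha(I)}{\alpha(I_1)\cdots\alpha(I_l)}\,\mathrm{Imm}_{\chi^{(1^{\lambda_1})}}(X_{I_1})\cdots\mathrm{Imm}_{\chi^{(1^{\lambda_l})}}(X_{I_l}),$$ $$\mathrm{Imm}_{\phi^\lambda}(X_I)=\sum_{(I_1,\dots,I_l)}\frac{\alpha(I)}{\alpha(I_1)\cdots\alpha(I_l)}\,\mathrm{Imm}_{\chi^{(\lambda_1)}}(X_{I_1})\cdots\mathrm{Imm}_{\chi^{(\lambda_l)}}(X_{I_l}),$$ where both sums run over all sequences $(I_1,\dots,I_l)$ of non-decreasing multisets of elements of $[m+n]$ with $|I_j|=\lambda_j$ whose disjoint union (as multisets) is $I$. -/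

import Mathlib

open scoped Nat

noncomputable section

namespace SuperImm

/-! ### The coordinate superalgebra `A(Mat_{m|n})` -/

/-- The parity of the index `i` (indices `0, …, m - 1` are even, `m, …, m + n - 1` are odd),
as the natural number `0` or `1`. -/
def parity {m n : ℕ} (i : Fin (m + n)) : ℕ := if (i : ℕ) < m then 0 else 1

/-- The parity of the generator `x_{ij}` (only its class modulo `2` matters). -/
def genParity {m n : ℕ} (a : Fin (m + n) × Fin (m + n)) : ℕ := parity a.1 + parity a.2

/-- Supercommutation of the generators: `x_a x_b = (-1)^{|a||b|} x_b x_a`. In particular the odd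
generators square to zero. -/
inductive SuperCommRel (m n : ℕ) :
    FreeAlgebra ℂ (Fin (m + n) × Fin (m + n)) → FreeAlgebra ℂ (Fin (m + n) × Fin (m + n)) → Prop
  | swap (a b : Fin (m + n) × Fin (m + n)) :
      SuperCommRel m n (FreeAlgebra.ι ℂ a * FreeAlgebra.ι ℂ b)
        ((-1 : ℂ) ^ (genParity a * genParity b) • (FreeAlgebra.ι ℂ b * FreeAlgebra.ι ℂ a))

/-- The coordinate superalgebra `A(Mat_{m|n})`: the free supercommutative `ℂ`-algebra on the
`x_{ij}`, where `x_{ij}` has parity `|i| + |j|`. -/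
abbrev Coord (m n : ℕ) : Type := RingQuot (SuperCommRel m n)

/-- The generator supermatrix `X = (x_{ij})` of `A(Mat_{m|n})`. -/
def genMatrix (m n : ℕ) : Matrix (Fin (m + n)) (Fin (m + n)) (Coord m n) :=
  fun i j => RingQuot.mkAlgHom ℂ (SuperCommRel m n) (FreeAlgebra.ι ℂ (i, j))

theorem genMatrix_mul_genMatrix (m n : ℕ) (a b : Fin (m + n) × Fin (m + n)) :
    genMatrix m n a.1 a.2 * genMatrix m n b.1 b.2 =
      (-1 : ℂ) ^ (genParity a * genParity b) •
        (genMatrix m n b.1 b.2 * genMatrix m n a.1 a.2) := by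
  have h := RingQuot.mkAlgHom_rel ℂ (SuperCommRel.swap (m := m) (n := n) a b)
  rw [map_smul, map_mul, map_mul] at h
  exact h

/-- The parity automorphism of `A(Mat_{m|n})`: the algebra endomorphism with
`x_{ij} ↦ (-1)^{|i| + |j|} x_{ij}`. It sends a homogeneous element `s` to `(-1)^{|s|} s`. -/
def parityAut (m n : ℕ) : Coord m n →ₐ[ℂ] Coord m n :=
  RingQuot.liftAlgHom ℂ
    ⟨FreeAlgebra.lift ℂ (fun a => (-1 : ℂ) ^ genParity a • genMatrix m n a.1 a.2), by
      rintro _ _ ⟨a, b⟩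
      simp only [map_mul, map_smul, FreeAlgebra.lift_ι_apply, smul_mul_smul_comm]
      rw [genMatrix_mul_genMatrix, smul_smul, smul_smul]
      congr 1
      ring⟩

/-! ### Operators on the super tensor space `A(Mat_{m|n}) ⊗ (ℂ^{m|n})^{⊗ r}` -/

/-- The super tensor space `A(Mat_{m|n}) ⊗ (ℂ^{m|n})^{⊗ r}`, in coordinates: the function `f`
stands for `∑_K f(K) ⊗ e_{k_1} ⊗ ⋯ ⊗ e_{k_r}`. -/
abbrev TensorSpace (m n r : ℕ) : Type := (Fin r → Fin (m + n)) → Coord m n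

/-- The parity of the basis tensor `e_{i_1} ⊗ ⋯ ⊗ e_{i_r}`. -/
def tupleParity {m n r : ℕ} (I : Fin r → Fin (m + n)) : ℕ := ∑ a, parity (I a)

/-- The exponent of the sign with which `σ` acts on `e_{i_1} ⊗ ⋯ ⊗ e_{i_r}`:
the sum of `|i_k| |i_l|` over `k < l` with `σ(k) > σ(l)`. -/
def permParity {m n r : ℕ} (I : Fin r → Fin (m + n)) (σ : Equiv.Perm (Fin r)) : ℕ :=
  ∑ k, ∑ l, if k < l ∧ σ l < σ k then parity (I k) * parity (I l) else 0

/-- The operator `P_σ`. It acts by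
`σ · (e_{i_1} ⊗ ⋯ ⊗ e_{i_r}) = (-1)^{I_σ} e_{i_{σ⁻¹(1)}} ⊗ ⋯ ⊗ e_{i_{σ⁻¹(r)}}`; hence the
coefficient of `e_K` in the image comes from the basis tensor `e_I` with `I = K ∘ σ`. -/
def permOp (m n : ℕ) {r : ℕ} (σ : Equiv.Perm (Fin r)) :
    TensorSpace m n r →ₗ[ℂ] TensorSpace m n r where
  toFun f K := (-1 : ℂ) ^ permParity (K ∘ σ) σ • f (K ∘ σ)
  map_add' f g := by
    funext K
    simp
  map_smul' c f := by
    funext K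
    exact smul_comm _ c (f (K ∘ σ))

/-- The operator `X_a = ∑_{i,j} x_{ij} ⊗ 1^{⊗ (a-1)} ⊗ e_{ij} ⊗ 1^{⊗ (r-a)}`, acting with the usual
sign rule: `x_{ij} ⊗ e_{ij}^{(a)}` sends `s ⊗ e_{k_1} ⊗ ⋯ ⊗ e_{k_r}`, where `k_a = j`, to
`(-1)^{(|i| + |j|)(|s| + |k_1| + ⋯ + |k_{a-1}|)} x_{ij} s ⊗ e_{k_1} ⊗ ⋯ ⊗ e_i ⊗ ⋯ ⊗ e_{k_r}`. -/
def genOp (m n : ℕ) {r : ℕ} (a : Fin r) : TensorSpace m n r →ₗ[ℂ] TensorSpace m n r where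
  toFun f K := ∑ j : Fin (m + n),
    (-1 : ℂ) ^ (genParity (K a, j) * ∑ b ∈ Finset.univ.filter (fun b => b < a), parity (K b)) •
      (genMatrix m n (K a) j *
        (parityAut m n ^ genParity (K a, j)) (f (Function.update K a j)))
  map_add' f g := by
    funext K
    simp only [Pi.add_apply, map_add, mul_add, smul_add, Finset.sum_add_distrib]
  map_smul' c f := by
    funext K
    simp only [Pi.smul_apply, map_smul, mul_smul_comm, RingHom.id_apply, Finset.smul_sum]
    exact Finset.sum_congr rfl fun j _ => smul_comm _ c _

/-- The product `X_1 X_2 ⋯ X_r` (composition of operators, `X_r` acts first). -/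
def genOpProd (m n r : ℕ) : Module.End ℂ (TensorSpace m n r) :=
  (List.ofFn fun a : Fin r => (genOp m n a : Module.End ℂ (TensorSpace m n r))).prod

/-- The action of the group algebra element `∑_σ χ(σ) σ` on the super tensor space. -/
def classFunOp (m n : ℕ) {r : ℕ} (χ : Equiv.Perm (Fin r) → ℂ) :
    Module.End ℂ (TensorSpace m n r) :=
  ∑ σ, χ σ • (permOp m n σ : Module.End ℂ (TensorSpace m n r))

/-- The vector `|i_1, …, i_r⟩ = 1 ⊗ e_{i_1} ⊗ ⋯ ⊗ e_{i_r}`. -/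
def ket {m n r : ℕ} (I : Fin r → Fin (m + n)) : TensorSpace m n r := Pi.single I 1

/-- The functional `⟨i_1, …, i_r| = (e_{i_1} ⊗ ⋯ ⊗ e_{i_r})^*`, of parity `|I|`, extended to
`A(Mat_{m|n}) ⊗ (ℂ^{m|n})^{⊗ r}` by the sign rule `s ⊗ e_I ↦ (-1)^{|I||s|} s`. -/
def bra {m n r : ℕ} (I : Fin r → Fin (m + n)) (f : TensorSpace m n r) : Coord m n :=
  (parityAut m n ^ tupleParity I) (f I)

/-- The super-immanant of the generalized submatrix `X^I_J` for the character `χ`: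
`Imm_χ(X^I_J) = (-1)^{∑_k |i_k||j_k|} ⟨i_1, …, i_r| χ X_1 ⋯ X_r |j_1, …, j_r⟩`. -/
def superImmanant (m n : ℕ) {r : ℕ} (χ : Equiv.Perm (Fin r) → ℂ) (I J : Fin r → Fin (m + n)) :
    Coord m n :=
  (-1 : ℂ) ^ (∑ k, parity (I k) * parity (J k)) •
    bra I ((classFunOp m n χ * genOpProd m n r) (ket J))

/-! ### Irreducible characters of the symmetric group -/

/-- The cell (row, column), counted from `0`, of the `i`-th entry in the tableau with row lengths
`L` that is numbered by rows downwards, from left to right in every row. -/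
def cellAt : List ℕ → ℕ → ℕ × ℕ
  | [], i => (0, i)
  | a :: L, i => if i < a then (0, i) else ((cellAt L (i - a)).1 + 1, (cellAt L (i - a)).2)

/-- The cell of the entry `i` in the row-reading tableau of shape `μ`. -/
def tableauCell {r : ℕ} (μ : Nat.Partition r) (i : Fin r) : ℕ × ℕ :=
  cellAt (μ.parts.sort (· ≥ ·)) i

/-- The Young symmetrizer of the row-reading tableau of shape `μ`: the sum of the permutations
that preserve the rows, times the signed sum of the permutations that preserve the columns. -/
def youngSymmetrizer {r : ℕ} (μ : Nat.Partition r) : MonoidAlgebra ℂ (Equiv.Perm (Fin r)) :=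
  (∑ σ ∈ Finset.univ.filter (fun σ : Equiv.Perm (Fin r) =>
      ∀ i, (tableauCell μ (σ i)).1 = (tableauCell μ i).1), MonoidAlgebra.single σ 1) *
  (∑ σ ∈ Finset.univ.filter (fun σ : Equiv.Perm (Fin r) =>
      ∀ i, (tableauCell μ (σ i)).2 = (tableauCell μ i).2),
    MonoidAlgebra.single σ ((Equiv.Perm.sign σ : ℤ) : ℂ))

/-- The Specht module `V^μ`: the left ideal of the group algebra generated by the Young
symmetrizer. -/
abbrev spechtModule {r : ℕ} (μ : Nat.Partition r) :
    Ideal (MonoidAlgebra ℂ (Equiv.Perm (Fin r))) :=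
  Ideal.span {youngSymmetrizer μ}

/-- The irreducible character `χ^μ` of the symmetric group: the character of `V^μ`. -/
def irrChar {r : ℕ} (μ : Nat.Partition r) : Equiv.Perm (Fin r) → ℂ :=
  (Representation.ofModule' (k := ℂ) (G := Equiv.Perm (Fin r)) (spechtModule μ)).character

/-- The one-row partition `(r)`. -/
def rowPartition (r : ℕ) : Nat.Partition r := Nat.Partition.indiscrete r

/-- The one-column partition `(1^r)`. -/
def colPartition (r : ℕ) : Nat.Partition r :=
  Nat.Partition.ofSums r (Multiset.replicate r 1) (by simp)

/-! ### Induced characters from Young subgroups -/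

/-- The block containing the position `i`, when the `k` positions are cut into `l` consecutive
blocks of sizes `lam 0, …, lam (l - 1)`. -/
def blockIndex {k l : ℕ} (lam : Fin l → ℕ) (h : ∑ j, lam j = k) (i : Fin k) : Fin l :=
  (finSigmaFinEquiv.symm (Fin.cast h.symm i)).1

/-- The parabolic (Young) subgroup `S_{lam_1} × ⋯ × S_{lam_l}` of `S_k`. -/
def youngSubgroup {k l : ℕ} (lam : Fin l → ℕ) (h : ∑ j, lam j = k) :
    Subgroup (Equiv.Perm (Fin k)) where
  carrier := {σ | ∀ i, blockIndex lam h (σ i) = blockIndex lam h i}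
  one_mem' i := rfl
  mul_mem' {σ τ} hσ hτ i := (hσ (τ i)).trans (hτ i)
  inv_mem' {σ} hσ i := by
    have h' := hσ (σ⁻¹ i)
    simpa using h'.symm

/-- The sign representation of a subgroup of the symmetric group. -/
def signRep {k : ℕ} (H : Subgroup (Equiv.Perm (Fin k))) : Representation ℂ H ℂ where
  toFun σ := ((Equiv.Perm.sign (σ : Equiv.Perm (Fin k)) : ℤ) : ℂ) • LinearMap.id
  map_one' := by
    ext
    simp
  map_mul' σ τ := by
    ext
    simp [mul_comm]

/-- The character `ψ^lam` of `S_k` induced from the sign character of the Young subgroup. -/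
def psi {k l : ℕ} (lam : Fin l → ℕ) (h : ∑ j, lam j = k) : Equiv.Perm (Fin k) → ℂ :=
  (Representation.ind (youngSubgroup lam h).subtype (signRep (youngSubgroup lam h))).character

/-- The character `φ^lam` of `S_k` induced from the trivial character of the Young subgroup. -/
def phi {k l : ℕ} (lam : Fin l → ℕ) (h : ∑ j, lam j = k) : Equiv.Perm (Fin k) → ℂ :=
  (Representation.ind (youngSubgroup lam h).subtype
    (Representation.trivial ℂ (youngSubgroup lam h) ℂ)).character

/-! ### Multisets of indices -/

/-- The multiset of entries of a tuple. -/
def entries {m n r : ℕ} (I : Fin r → Fin (m + n)) : Multiset (Fin (m + n)) :=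
  Finset.univ.val.map I

/-- `α(I) = α_1! α_2! ⋯ α_{m+n}!`, where `α_i` is the multiplicity of `i` in `I`. -/
def alphaFactorial {m n r : ℕ} (I : Fin r → Fin (m + n)) : ℕ :=
  ∏ i, ((entries I).count i)!

open Classical in
/-- The sequences `(I_1, …, I_l)` of non-decreasing multisets with `|I_j| = lam_j` whose disjoint
union (as multisets) is `I`. -/
def decompositions {m n k l : ℕ} (lam : Fin l → ℕ) (I : Fin k → Fin (m + n)) :
    Finset ((j : Fin l) → Fin (lam j) → Fin (m + n)) :=
  Finset.univ.filter fun D => (∀ j, Monotone (D j)) ∧ ∑ j, entries (D j) = entries I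

end SuperImm

end

/-! Expanding the matrix coefficient writes a super-immanant as `∑ σ, χ σ • immTerm I σ`, each term
a signed monomial (`superImmanant_eq_sum`). Two properties of the terms carry the proof.

Rearranging `I` by `τ` only conjugates the permutation (`immTerm_comp_perm`): reordering the
supercommuting entries costs a Koszul sign, which the signs of the operators absorb by the cocycle
rule `koszul_mul`. And if `σ` preserves consecutive blocks, its term is the ordered product of the
terms of the blocks (`immTerm_glue`), because the signs between different blocks cancel in total.

An induced character is `|H|⁻¹ ∑ ζ(x σ x⁻¹)` over all `x`, with `ζ` extended by zero outside `H`
(`character_ind`). By the two properties, its super-immanant is `1 / ∏ λ_j!` times the sum over all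
rearrangements `I ∘ x` of the products of the super-immanants of the blocks
(`superImmanant_induced`). The sign and trivial characters are class functions, so such a product
depends only on the multisets `I_j` in the blocks. A given concatenation equals `I ∘ x` for `α(I)`
choices of `x`, and `I_j` has `λ_j! / α(I_j)` orderings; this leaves the weight `α(I) / ∏ α(I_j)`
(`sum_perm_blocks`). Finally, the Young symmetrizers of one column and one row generate the sign and
trivial representations. -/

noncomputable section

namespace SuperImm

/-! ### Products over pairs of positions and Koszul signs -/

/-- The product of `h a b` over all pairs `a < b`. -/
def pairProd {M : Type*} [CommMonoid M] {r : ℕ} (h : Fin r → Fin r → M) : M :=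
  ∏ a, ∏ b, if a < b then h a b else 1

theorem pairProd_congr {M : Type*} [CommMonoid M] {r : ℕ} {h h' : Fin r → Fin r → M}
    (H : ∀ a b, a < b → h a b = h' a b) : pairProd h = pairProd h' := by
  refine Finset.prod_congr rfl fun a _ => Finset.prod_congr rfl fun b _ => ?_
  split_ifs with hab
  · exact H a b hab
  · rfl

theorem pairProd_mul {M : Type*} [CommMonoid M] {r : ℕ} (h h' : Fin r → Fin r → M) :
    pairProd (fun a b => h a b * h' a b) = pairProd h * pairProd h' := by
  simp only [pairProd, ← Finset.prod_mul_distrib]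
  refine Finset.prod_congr rfl fun a _ => Finset.prod_congr rfl fun b _ => ?_
  split_ifs <;> simp

theorem pairProd_eq_prod_filter {M : Type*} [CommMonoid M] {r : ℕ} (h : Fin r → Fin r → M) :
    pairProd h = ∏ x ∈ Finset.univ.filter (fun x : Fin r × Fin r => x.1 < x.2), h x.1 x.2 := by
  rw [pairProd, Finset.prod_filter, Fintype.prod_prod_type]

/-- The product over pairs of a symmetric function is invariant under permuting the positions. -/
theorem pairProd_comp_perm {M : Type*} [CommMonoid M] {r : ℕ} (h : Fin r → Fin r → M)
    (hs : ∀ a b, h a b = h b a) (τ : Equiv.Perm (Fin r)) :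
    pairProd (fun a b => h (τ a) (τ b)) = pairProd h := by
  rw [pairProd_eq_prod_filter, pairProd_eq_prod_filter]
  refine Finset.prod_nbij'
    (fun x => if τ x.1 < τ x.2 then (τ x.1, τ x.2) else (τ x.2, τ x.1))
    (fun x => if τ.symm x.1 < τ.symm x.2 then (τ.symm x.1, τ.symm x.2)
      else (τ.symm x.2, τ.symm x.1)) ?_ ?_ ?_ ?_ ?_
  · rintro ⟨a, b⟩ hab
    simp only [Finset.mem_filter, Finset.mem_univ, true_and] at hab ⊢
    have : τ a ≠ τ b := fun e => hab.ne (τ.injective e)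
    split_ifs with h1
    · exact h1
    · exact lt_of_le_of_ne (not_lt.1 h1) this.symm
  · rintro ⟨a, b⟩ hab
    simp only [Finset.mem_filter, Finset.mem_univ, true_and] at hab ⊢
    have : τ.symm a ≠ τ.symm b := fun e => hab.ne (τ.symm.injective e)
    split_ifs with h1
    · exact h1
    · exact lt_of_le_of_ne (not_lt.1 h1) this.symm
  · rintro ⟨a, b⟩ hab
    simp only [Finset.mem_filter, Finset.mem_univ, true_and] at hab
    by_cases h1 : τ a < τ b
    · simp [h1, hab]
    · simp [h1, hab.not_gt]
  · rintro ⟨a, b⟩ hab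
    simp only [Finset.mem_filter, Finset.mem_univ, true_and] at hab
    by_cases h1 : τ.symm a < τ.symm b
    · simp [h1, hab]
    · simp [h1, hab.not_gt]
  · rintro ⟨a, b⟩ _
    by_cases h1 : τ a < τ b
    · simp [h1]
    · simpa [h1] using hs _ _

/-- Only values with first argument smaller matter, so `h` may be replaced by its symmetrization, to
which the symmetric case applies. -/
theorem pairProd_comp_perm' {M : Type*} [CommMonoid M] {r : ℕ} (h : Fin r → Fin r → M)
    (τ : Equiv.Perm (Fin r)) :
    pairProd h = pairProd fun a b =>
      if τ a < τ b then h (τ a) (τ b) else h (τ b) (τ a) := by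
  have h1 := pairProd_comp_perm (fun a b => if a < b then h a b else if b < a then h b a else 1)
    (fun a b => by
      rcases lt_trichotomy a b with hab | rfl | hab
      · simp [hab, hab.not_gt]
      · simp
      · simp [hab, hab.not_gt]) τ
  rw [pairProd_congr (h := h)
    (h' := fun a b => if a < b then h a b else if b < a then h b a else 1)
    (fun a b hab => by simp [hab]), ← h1]
  refine pairProd_congr fun a b hab => ?_
  have : τ a ≠ τ b := fun e => hab.ne (τ.injective e)
  rcases lt_or_gt_of_ne this with h2 | h2 <;> simp [h2, h2.not_gt]

theorem neg_one_pow_mul_self (e : ℕ) : (-1 : ℂ) ^ e * (-1 : ℂ) ^ e = 1 := by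
  rw [← mul_pow]; simp

theorem neg_one_pow_eq_of_parity {a b : ℕ} (h : Even (a + b)) : (-1 : ℂ) ^ a = (-1 : ℂ) ^ b := by
  have h1 : (-1 : ℂ) ^ a * (-1) ^ b = 1 := by rw [← pow_add, h.neg_one_pow]
  calc (-1 : ℂ) ^ a = (-1) ^ a * ((-1) ^ b * (-1) ^ b) := by rw [neg_one_pow_mul_self, mul_one]
    _ = (-1) ^ b := by rw [← mul_assoc, h1, one_mul]

/-- The Koszul sign of rearranging homogeneous elements of parities `p` by `σ`. -/
def koszul {r : ℕ} (p : Fin r → ℕ) (σ : Equiv.Perm (Fin r)) : ℂ :=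
  pairProd fun a b => if σ b < σ a then (-1 : ℂ) ^ (p (σ a) * p (σ b)) else 1

/-- Compare pair by pair: `σ * τ` inverts a pair exactly when one of the two steps reverses its
order; when both do, the two equal signs cancel. -/
theorem koszul_mul {r : ℕ} (p : Fin r → ℕ) (σ τ : Equiv.Perm (Fin r)) :
    koszul p (σ * τ) = koszul p σ * koszul (p ∘ σ) τ := by
  rw [koszul, koszul, koszul, pairProd_comp_perm' (fun a b => if σ b < σ a then
    (-1 : ℂ) ^ (p (σ a) * p (σ b)) else 1) τ, ← pairProd_mul]
  refine pairProd_congr fun a b hab => ?_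
  have h1 : τ a ≠ τ b := fun e => hab.ne (τ.injective e)
  have h2 : σ (τ a) ≠ σ (τ b) := fun e => h1 (σ.injective e)
  have h3 := neg_one_pow_mul_self (p (σ (τ a)) * p (σ (τ b)))
  simp only [Equiv.Perm.mul_apply, Function.comp]
  rcases lt_or_gt_of_ne h1 with h1 | h1 <;> rcases lt_or_gt_of_ne h2 with h2 | h2 <;>
    simp [h1, h1.not_gt, h2, h2.not_gt, mul_comm (p (σ (τ b))) (p (σ (τ a))), h3]

theorem koszul_one {r : ℕ} (p : Fin r → ℕ) : koszul p 1 = 1 := by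
  rw [koszul, pairProd_congr (h' := fun _ _ => 1)]
  · simp [pairProd]
  · intro a b hab
    simp [hab.not_gt]

theorem koszul_mul_self {r : ℕ} (p : Fin r → ℕ) (σ : Equiv.Perm (Fin r)) :
    koszul p σ * koszul p σ = 1 := by
  rw [koszul, ← pairProd_mul, pairProd_congr (h' := fun _ _ => 1)]
  · simp [pairProd]
  · intro a b _
    split_ifs
    · exact neg_one_pow_mul_self _
    · simp

/-- `permParity` reads the parities of the source tensor `K ∘ σ`, which at position `a` is `K (σ
a)`; this is how the sign of `permOp` enters the Koszul calculus. -/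
theorem neg_one_pow_permParity {m n r : ℕ} (K : Fin r → Fin (m + n)) (σ : Equiv.Perm (Fin r)) :
    (-1 : ℂ) ^ permParity (K ∘ σ) σ = koszul (fun a => parity (K a)) σ := by
  rw [permParity, koszul, pairProd, ← Finset.prod_pow_eq_pow_sum]
  refine Finset.prod_congr rfl fun a _ => ?_
  rw [← Finset.prod_pow_eq_pow_sum]
  refine Finset.prod_congr rfl fun b _ => ?_
  by_cases h1 : a < b <;> by_cases h2 : σ b < σ a <;> simp [h1, h2]

/-- The sign is the all-odd Koszul sign, so `koszul_glue` also yields its multiplicativity over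
blocks. -/
theorem sign_eq_koszul {r : ℕ} (σ : Equiv.Perm (Fin r)) :
    ((Equiv.Perm.sign σ : ℤ) : ℂ) = koszul (fun _ => 1) σ := by
  rw [Equiv.Perm.sign_eq_prod_prod_Ioi, koszul, pairProd]
  push_cast
  refine Finset.prod_congr rfl fun a _ => ?_
  rw [← Finset.prod_filter, ← Finset.filter_lt_eq_Ioi]
  refine Finset.prod_congr rfl fun b hb => ?_
  have : σ a ≠ σ b := fun e => (Finset.mem_filter.1 hb).2.ne (σ.injective e)
  rcases lt_or_gt_of_ne this with h2 | h2 <;> simp [h2, h2.not_gt]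

theorem swap_castSucc_succ_lt_iff {r : ℕ} (i : Fin r) {a b : Fin (r + 1)} (hab : a < b) :
    Equiv.swap i.castSucc i.succ b < Equiv.swap i.castSucc i.succ a ↔
      a = i.castSucc ∧ b = i.succ := by
  simp only [Equiv.swap_apply_def]
  split_ifs <;> simp only [Fin.ext_iff, Fin.lt_def, Fin.val_castSucc, Fin.val_succ] at * <;> omega

theorem koszul_swap {r : ℕ} (p : Fin (r + 1) → ℕ) (i : Fin r) :
    koszul p (Equiv.swap i.castSucc i.succ) = (-1 : ℂ) ^ (p i.succ * p i.castSucc) := by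
  rw [koszul, pairProd_congr (h' := fun a b => if a = i.castSucc ∧ b = i.succ then
    (-1 : ℂ) ^ (p i.succ * p i.castSucc) else 1), pairProd,
    Finset.prod_eq_single i.castSucc, Finset.prod_eq_single i.succ]
  · simp
  · intro b _ hb; simp [hb]
  · simp
  · intro b _ hb; simp [hb]
  · simp
  · intro a b hab
    simp only [swap_castSucc_succ_lt_iff i hab]
    split_ifs with h
    · obtain ⟨rfl, rfl⟩ := h; simp
    · rfl

theorem prod_ofFn_swap {A : Type*} [Ring A] [Algebra ℂ A] {r : ℕ} (y : Fin (r + 1) → A)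
    (i : Fin r) (c : ℂ) (h : y i.succ * y i.castSucc = c • (y i.castSucc * y i.succ)) :
    (List.ofFn (y ∘ Equiv.swap i.castSucc i.succ)).prod = c • (List.ofFn y).prod := by
  induction r with
  | zero => exact i.elim0
  | succ r ih =>
    cases i using Fin.cases with
    | zero =>
      have e : ∀ j : Fin r, Equiv.swap (0 : Fin (r + 2)) 1 j.succ.succ = j.succ.succ := fun j =>
        Equiv.swap_apply_of_ne_of_ne (Fin.succ_ne_zero _) (by simp [Fin.ext_iff])
      simp only [Fin.castSucc_zero, Fin.succ_zero_eq_one] at h ⊢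
      simp only [List.ofFn_succ, List.prod_cons, Function.comp_apply, Equiv.swap_apply_left,
        Fin.succ_zero_eq_one, Equiv.swap_apply_right, e]
      rw [← mul_assoc, h, smul_mul_assoc, mul_assoc]
    | succ i =>
      have e : ∀ j : Fin (r + 1), Equiv.swap i.succ.castSucc i.succ.succ j.succ =
          (Equiv.swap i.castSucc i.succ j).succ := fun j => by
        rw [← Fin.succ_castSucc]
        exact ((Fin.succ_injective _).swap_apply _ _ _)
      have e0 : Equiv.swap i.succ.castSucc i.succ.succ 0 = 0 :=
        Equiv.swap_apply_of_ne_of_ne (by simp [Fin.ext_iff]) (by simp [Fin.ext_iff])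
      have := ih (y ∘ Fin.succ) i (by simpa using h)
      rw [List.ofFn_succ, List.prod_cons, List.ofFn_succ (f := y), List.prod_cons]
      simp only [Function.comp_apply, e, e0]
      simp only [Function.comp_def] at this
      rw [this, mul_smul_comm]

/-- Rearranging a product of supercommuting elements produces the Koszul sign. -/
theorem prod_ofFn_comp_perm {A : Type*} [Ring A] [Algebra ℂ A] {r : ℕ} (τ : Equiv.Perm (Fin r))
    (y : Fin r → A) (p : Fin r → ℕ)
    (h : ∀ a b, y a * y b = (-1 : ℂ) ^ (p a * p b) • (y b * y a)) :
    (List.ofFn (y ∘ τ)).prod = koszul p τ • (List.ofFn y).prod := by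
  cases r with
  | zero =>
    rw [Subsingleton.elim τ 1, koszul_one, one_smul]; rfl
  | succ r =>
    have hτ : τ ∈ Submonoid.closure
        (Set.range fun i : Fin r => Equiv.swap i.castSucc i.succ) := by
      rw [Equiv.Perm.mclosure_swap_castSucc_succ]; trivial
    -- Adjacent transpositions generate the group as a monoid. The family must vary, since the
    -- product case applies the hypothesis to `y ∘ σ` with parities `p ∘ σ`.
    induction hτ using Submonoid.closure_induction generalizing y p with
    | mem x hx =>
      obtain ⟨i, rfl⟩ := hx
      rw [koszul_swap]
      exact prod_ofFn_swap y i _ (h _ _)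
    | one => rw [koszul_one, one_smul]; rfl
    | mul σ τ _ _ ih1 ih2 =>
      rw [koszul_mul, Equiv.Perm.coe_mul, ← Function.comp_assoc,
        ih2 (y ∘ σ) (p ∘ σ) (fun a b => h _ _), ih1 y p h, smul_smul, mul_comm]

/-- The sign in front of the monomial `x_{K_1 J_1} ⋯ x_{K_r J_r}` in the matrix coefficient of
`X_1 ⋯ X_r`. -/
def coeffSign {r : ℕ} (k j : Fin r → ℕ) : ℂ :=
  pairProd fun a b => (-1 : ℂ) ^ (k a * (k b + j b))

/-- Pairs that `τ` does not invert give equal factors on both sides; for an inverted pair the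
exponents agree modulo 2. -/
theorem coeffSign_comp_perm {r : ℕ} (k j : Fin r → ℕ) (τ : Equiv.Perm (Fin r)) :
    coeffSign (k ∘ τ) (j ∘ τ) * koszul (fun a => k a + j a) τ =
      koszul k τ * koszul j τ * coeffSign k j := by
  rw [coeffSign, coeffSign, koszul, koszul, koszul,
    pairProd_comp_perm' (fun a b => (-1 : ℂ) ^ (k a * (k b + j b))) τ, ← pairProd_mul,
    ← pairProd_mul, ← pairProd_mul]
  refine pairProd_congr fun a b hab => ?_
  have h1 : τ a ≠ τ b := fun e => hab.ne (τ.injective e)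
  rcases lt_or_gt_of_ne h1 with h1 | h1
  · simp [h1, h1.not_gt]
  · simp only [h1, h1.not_gt, if_true, if_false, ← pow_add, Function.comp]
    refine neg_one_pow_eq_of_parity ?_
    generalize k (τ a) = x, k (τ b) = y, j (τ a) = z, j (τ b) = w
    exact ⟨x * y + x * w + (x * y + z * w + y * z), by ring⟩

/-! ### Matrix coefficients of `X_1 ⋯ X_r` -/

/-- The parities of the entries of a tuple. -/
def parities {m n r : ℕ} (I : Fin r → Fin (m + n)) : Fin r → ℕ := fun a => parity (I a)

theorem parityAut_genMatrix (m n : ℕ) (i j : Fin (m + n)) :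
    parityAut m n (genMatrix m n i j) = (-1 : ℂ) ^ genParity (i, j) • genMatrix m n i j := by
  conv_lhs => rw [genMatrix, parityAut, RingQuot.liftAlgHom_mkAlgHom_apply]
  simp

theorem parityAut_pow_of_eq_smul {m n : ℕ} {s : Coord m n} {p : ℕ}
    (h : parityAut m n s = (-1 : ℂ) ^ p • s) (g : ℕ) :
    (parityAut m n ^ g) s = (-1 : ℂ) ^ (g * p) • s := by
  induction g with
  | zero => simp
  | succ g ih =>
    rw [pow_succ', AlgHom.mul_apply, ih, map_smul, h, smul_smul, ← pow_add, add_mul, one_mul]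

/-- The sum of `p b` over the positions `b ≥ c`. -/
def tailSum {r : ℕ} (p : Fin r → ℕ) (c : ℕ) : ℕ := ∑ b : Fin r, if c ≤ b then p b else 0

theorem tailSum_eq_add {r : ℕ} (p : Fin r → ℕ) (c : Fin r) :
    tailSum p c = p c + tailSum p (c + 1) := by
  have : p c = ∑ b : Fin r, if b = c then p c else 0 := by simp
  rw [tailSum, this, tailSum, ← Finset.sum_add_distrib]
  refine Finset.sum_congr rfl fun b _ => ?_
  rcases lt_trichotomy b c with h | rfl | h
  · have h1 : ¬ (c : ℕ) ≤ b := not_le.2 h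
    have h2 : ¬ (c : ℕ) + 1 ≤ b := by omega
    simp [h1, h2, h.ne]
  · simp
  · have h1 : (c : ℕ) ≤ b := le_of_lt h
    have h2 : (c : ℕ) + 1 ≤ b := h
    simp [h1, h2, h.ne']

theorem prod_drop_ofFn {M : Type*} [Monoid M] {r : ℕ} (y : Fin r → M) (c : Fin r) :
    ((List.ofFn y).drop c).prod = y c * ((List.ofFn y).drop (c + 1)).prod := by
  rw [List.drop_eq_getElem_cons (by simp), List.prod_cons]
  simp

theorem parityAut_prod_drop {m n r : ℕ} (y : Fin r → Coord m n) (p : Fin r → ℕ)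
    (h : ∀ a, parityAut m n (y a) = (-1 : ℂ) ^ p a • y a) (c : ℕ) (hc : c ≤ r) :
    parityAut m n ((List.ofFn y).drop c).prod =
      (-1 : ℂ) ^ tailSum p c • ((List.ofFn y).drop c).prod := by
  induction hc using Nat.decreasingInduction with
  | self =>
    have : tailSum p r = 0 := Finset.sum_eq_zero fun b _ => if_neg (by omega)
    rw [List.drop_of_length_le (by simp)]; simp [this]
  | of_succ c hc ih =>
    have h1 := prod_drop_ofFn y ⟨c, hc⟩
    have h2 := tailSum_eq_add p ⟨c, hc⟩
    simp only at h1 h2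
    rw [h1, map_mul, h, ih, h2, smul_mul_smul_comm, pow_add]

/-- The entries `x_{K_a J_a}` of the generator matrix. -/
def genEntries {m n r : ℕ} (K J : Fin r → Fin (m + n)) : Fin r → Coord m n :=
  fun a => genMatrix m n (K a) (J a)

/-- The sign of the coefficient of `X_{c+1} ⋯ X_r`. -/
def tailSign {r : ℕ} (k j : Fin r → ℕ) (c : ℕ) : ℂ :=
  ∏ a : Fin r, if c ≤ a then (-1 : ℂ) ^ ((k a + j a) *
    (∑ b ∈ Finset.univ.filter (fun b => b < a), j b + tailSum (fun b => k b + j b) (a + 1)))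
    else 1

theorem tailSign_eq_mul {r : ℕ} (k j : Fin r → ℕ) (c : Fin r) :
    tailSign k j c = (-1 : ℂ) ^ ((k c + j c) *
      (∑ b ∈ Finset.univ.filter (fun b => b < c), j b +
        tailSum (fun b => k b + j b) (c + 1))) * tailSign k j (c + 1) := by
  set f : Fin r → ℂ := fun a => (-1 : ℂ) ^ ((k a + j a) *
    (∑ b ∈ Finset.univ.filter (fun b => b < a), j b + tailSum (fun b => k b + j b) (a + 1)))
  change (∏ a : Fin r, if (c : ℕ) ≤ a then f a else 1) =
    f c * ∏ a : Fin r, if (c : ℕ) + 1 ≤ a then f a else 1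
  have : f c = ∏ b : Fin r, if b = c then f c else 1 := by simp
  rw [this, ← Finset.prod_mul_distrib]
  refine Finset.prod_congr rfl fun b _ => ?_
  rcases lt_trichotomy b c with h | rfl | h
  · have h1 : ¬ (c : ℕ) ≤ b := not_le.2 h
    have h2 : ¬ (c : ℕ) + 1 ≤ b := by omega
    simp [h1, h2, h.ne]
  · simp
  · have h1 : (c : ℕ) ≤ b := le_of_lt h
    have h2 : (c : ℕ) + 1 ≤ b := h
    simp [h1, h2, h.ne']

theorem tailSum_congr {r : ℕ} {p p' : Fin r → ℕ} {c : ℕ} (h : ∀ b : Fin r, c ≤ b → p b = p' b) :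
    tailSum p c = tailSum p' c := by
  refine Finset.sum_congr rfl fun b _ => ?_
  split_ifs with hb
  · exact h b hb
  · rfl

theorem tailSign_congr {r : ℕ} {k k' j : Fin r → ℕ} {c : ℕ}
    (h : ∀ b : Fin r, c ≤ b → k b = k' b) : tailSign k j c = tailSign k' j c := by
  refine Finset.prod_congr rfl fun a _ => ?_
  split_ifs with ha
  · rw [h a ha, tailSum_congr (p' := fun b => k' b + j b)]
    intro b hb
    rw [h b (by omega)]
  · rfl

theorem drop_ofFn_congr {M : Type*} {r : ℕ} {y y' : Fin r → M} {c : ℕ}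
    (h : ∀ b : Fin r, c ≤ b → y b = y' b) : (List.ofFn y).drop c = (List.ofFn y').drop c := by
  apply List.ext_getElem
  · simp
  · intro i h1 h2
    simp only [List.getElem_drop, List.getElem_ofFn]
    exact h _ (by simp)

/-- A pair `a < b` contributes `j a * (k b + j b)` when the operator at `b` passes the basis vector
at `a`, and `(k a + j a) * (k b + j b)` when the operator at `a` passes the entry from `b`. Modulo 2
the sum is `k a * (k b + j b)`. -/
theorem tailSign_zero {r : ℕ} (k j : Fin r → ℕ) : tailSign k j 0 = coeffSign k j := by
  have h : ∀ a : Fin r, (-1 : ℂ) ^ ((k a + j a) *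
      (∑ b ∈ Finset.univ.filter (fun b => b < a), j b + tailSum (fun b => k b + j b) (a + 1))) =
      (∏ b, if b < a then (-1 : ℂ) ^ ((k a + j a) * j b) else 1) *
      ∏ b, if a < b then (-1 : ℂ) ^ ((k a + j a) * (k b + j b)) else 1 := by
    intro a
    rw [mul_add, pow_add, Finset.mul_sum, ← Finset.prod_pow_eq_pow_sum, Finset.prod_filter,
      tailSum, Finset.mul_sum, ← Finset.prod_pow_eq_pow_sum]
    congr 1
    refine Finset.prod_congr rfl fun b _ => ?_
    by_cases hb : a < b
    · have : (a : ℕ) + 1 ≤ b := hb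
      simp [hb, this]
    · have : ¬ (a : ℕ) + 1 ≤ b := hb
      simp [hb, this]
  simp only [tailSign, zero_le, if_true, h]
  rw [Finset.prod_mul_distrib, Finset.prod_comm]
  change pairProd (fun a b => (-1 : ℂ) ^ ((k b + j b) * j a)) *
    pairProd (fun a b => (-1 : ℂ) ^ ((k a + j a) * (k b + j b))) = _
  rw [← pairProd_mul]
  refine pairProd_congr fun a b _ => ?_
  rw [← pow_add]
  refine neg_one_pow_eq_of_parity ⟨(k a + j a) * (k b + j b), by ring⟩

theorem parityAut_genEntries {m n r : ℕ} (K J : Fin r → Fin (m + n)) (a : Fin r) :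
    parityAut m n (genEntries K J a) =
      (-1 : ℂ) ^ (parities K a + parities J a) • genEntries K J a :=
  parityAut_genMatrix m n _ _

theorem genOp_apply {m n r : ℕ} (a : Fin r) (f : TensorSpace m n r) (K : Fin r → Fin (m + n)) :
    genOp m n a f K = ∑ j : Fin (m + n),
      (-1 : ℂ) ^ (genParity (K a, j) * ∑ b ∈ Finset.univ.filter (fun b => b < a), parity (K b)) •
        (genMatrix m n (K a) j *
          (parityAut m n ^ genParity (K a, j)) (f (Function.update K a j))) :=
  rfl

/-- Since `X_r` acts first, the partial products are the tails of the list, treated by downward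
induction. The operators in the tail leave the first `c` tensor factors alone, hence the condition
`K b = J b` there. -/
theorem prod_drop_genOp_ket {m n r : ℕ} (J K : Fin r → Fin (m + n)) (c : ℕ) (hc : c ≤ r) :
    ((List.ofFn fun a : Fin r => (genOp m n a : Module.End ℂ (TensorSpace m n r))).drop c).prod
      (ket J) K =
      if ∀ b : Fin r, (b : ℕ) < c → K b = J b then
        tailSign (parities K) (parities J) c • ((List.ofFn (genEntries K J)).drop c).prod
      else 0 := by
  induction hc using Nat.decreasingInduction generalizing K with
  | self =>
    have h1 : tailSign (parities K) (parities J) r = 1 :=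
      Finset.prod_eq_one fun b _ => if_neg (by omega)
    rw [List.drop_of_length_le (by simp), List.drop_of_length_le (by simp), h1]
    simp only [List.prod_nil, Module.End.one_apply, one_smul, ket, Pi.single_apply, Fin.is_lt,
      forall_const, ← funext_iff]
  | of_succ c hc ih =>
    have h1 := prod_drop_ofFn
      (fun a : Fin r => (genOp m n a : Module.End ℂ (TensorSpace m n r))) ⟨c, hc⟩
    simp only at h1
    rw [h1, Module.End.mul_apply]
    set c' : Fin r := ⟨c, hc⟩ with hc'
    rw [genOp_apply]
    simp only [ih]
    split_ifs with hK
    · have hupd : ∀ b : Fin r, (b : ℕ) < c + 1 → Function.update K c' (J c') b = J b := by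
        intro b hb
        by_cases hbc : b = c'
        · subst hbc; simp
        · rw [Function.update_of_ne hbc]
          have : (b : ℕ) ≠ c := fun e => hbc (Fin.ext e)
          exact hK b (by omega)
      have hne : ∀ b : Fin r, c + 1 ≤ (b : ℕ) → Function.update K c' (J c') b = K b := by
        intro b hb
        refine Function.update_of_ne (fun e => ?_) _ _
        rw [e, hc'] at hb
        simp at hb
      -- The later operators have not touched position `c`, so only the column `J c` survives.
      rw [Finset.sum_eq_single (J c'), if_pos hupd]
      · rw [tailSign_congr (k' := parities K) (fun b hb => by simp only [parities, hne b hb]),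
          drop_ofFn_congr (y' := genEntries K J) (fun b hb => by simp only [genEntries, hne b hb]),
          map_smul, parityAut_pow_of_eq_smul
            (parityAut_prod_drop _ _ (parityAut_genEntries K J) (c + 1) hc)]
        have h2 := prod_drop_ofFn (genEntries K J) c'
        have h3 := tailSign_eq_mul (parities K) (parities J) c'
        have h4 : ∑ b ∈ Finset.univ.filter (fun b => b < c'), parity (K b) =
            ∑ b ∈ Finset.univ.filter (fun b => b < c'), parities J b := by
          refine Finset.sum_congr rfl fun b hb => ?_
          rw [hK b (Finset.mem_filter.1 hb).2, parities]
        simp only [hc'] at h2 h3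
        rw [h2, h3, h4, mul_smul_comm, mul_smul_comm, smul_smul, smul_smul]
        congr 1
        rw [mul_add, pow_add]
        simp only [genParity, parities, hc']
        ring
      · intro j _ hj
        rw [if_neg, map_zero, mul_zero, smul_zero]
        intro h
        have := h c' (by simp [hc'])
        rw [Function.update_self] at this
        exact hj this
      · simp
    · refine Finset.sum_eq_zero fun j _ => ?_
      rw [if_neg, map_zero, mul_zero, smul_zero]
      intro h
      refine hK fun b hb => ?_
      have := h b (by omega)
      rwa [Function.update_of_ne (fun e => by rw [e, hc'] at hb; simp at hb)] at this

/-- The matrix coefficient `⟨K| X_1 ⋯ X_r |J⟩` up to the sign of the functional. -/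
def coeff {m n r : ℕ} (K J : Fin r → Fin (m + n)) : Coord m n :=
  coeffSign (parities K) (parities J) • (List.ofFn (genEntries K J)).prod

theorem genOpProd_ket {m n r : ℕ} (J K : Fin r → Fin (m + n)) :
    genOpProd m n r (ket J) K = coeff K J := by
  have := prod_drop_genOp_ket J K 0 (Nat.zero_le _)
  simpa [tailSign_zero, coeff, genOpProd] using this

theorem parityAut_coeff {m n r : ℕ} (K J : Fin r → Fin (m + n)) :
    parityAut m n (coeff K J) =
      (-1 : ℂ) ^ (∑ a, (parities K a + parities J a)) • coeff K J := by
  have := parityAut_prod_drop _ _ (parityAut_genEntries K J) 0 (Nat.zero_le _)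
  simp only [List.drop_zero, tailSum, zero_le, if_true] at this
  rw [coeff, map_smul, this, smul_comm]

theorem sum_parities_comp_perm {m n r : ℕ} (I : Fin r → Fin (m + n)) (σ : Equiv.Perm (Fin r)) :
    ∑ a, parities (I ∘ σ) a = ∑ a, parities I a :=
  Equiv.sum_comp σ (parities I)

/-- `I ∘ σ` and `I` have the same total parity, so the coefficient is even and the sign rule for the
dual functional has no effect. -/
theorem parityAut_pow_coeff_comp_perm {m n r : ℕ} (I : Fin r → Fin (m + n))
    (σ : Equiv.Perm (Fin r)) (g : ℕ) :
    (parityAut m n ^ g) (coeff (I ∘ σ) I) = coeff (I ∘ σ) I := by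
  rw [parityAut_pow_of_eq_smul (parityAut_coeff _ _), Finset.sum_add_distrib,
    sum_parities_comp_perm, Even.neg_one_pow ((Even.add_self _).mul_left _), one_smul]

/-! ### Super-immanants as sums over permutations, and rearrangement of the indices -/

/-- The contribution of a single permutation to the super-immanant. -/
def immTerm {m n r : ℕ} (I : Fin r → Fin (m + n)) (σ : Equiv.Perm (Fin r)) : Coord m n :=
  ((-1 : ℂ) ^ (∑ a, parities I a) * koszul (parities I) σ) • coeff (I ∘ σ) I

theorem superImmanant_eq_sum {m n r : ℕ} (χ : Equiv.Perm (Fin r) → ℂ) (I : Fin r → Fin (m + n)) :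
    superImmanant m n χ I I = ∑ σ, χ σ • immTerm I σ := by
  -- Parities are `0` or `1`, hence idempotent, so the prefactor is the sign of the total parity.
  have hp : ∀ k, parity (I k) * parity (I k) = parities I k := by
    intro k
    simp only [parities, parity]
    split_ifs <;> rfl
  rw [superImmanant, bra, Module.End.mul_apply, classFunOp, LinearMap.sum_apply,
    Finset.sum_apply, map_sum, Finset.smul_sum]
  refine Finset.sum_congr rfl fun σ _ => ?_
  simp only [LinearMap.smul_apply, Pi.smul_apply, permOp, LinearMap.coe_mk, AddHom.coe_mk,
    genOpProd_ket, map_smul, parityAut_pow_coeff_comp_perm, neg_one_pow_permParity, hp]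
  rw [immTerm, smul_comm, smul_smul ((-1 : ℂ) ^ _)]
  rfl

/-- Simultaneous permutation of rows and columns. -/
theorem coeff_comp_perm {m n r : ℕ} (K J : Fin r → Fin (m + n)) (τ : Equiv.Perm (Fin r)) :
    coeff (K ∘ τ) (J ∘ τ) = (koszul (parities K) τ * koszul (parities J) τ) • coeff K J := by
  have h1 := prod_ofFn_comp_perm τ (genEntries K J) (fun a => parities K a + parities J a)
    (fun a b => genMatrix_mul_genMatrix m n (K a, J a) (K b, J b))
  have h2 := coeffSign_comp_perm (parities K) (parities J) τ
  change coeffSign (parities K ∘ τ) (parities J ∘ τ) • (List.ofFn (genEntries K J ∘ τ)).prod = _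
  rw [h1, smul_smul, h2, coeff, smul_smul]

/-- With `σ' = τ σ τ⁻¹`, the cocycle rule applied to both sides of `τ σ = σ' τ` relates the four
Koszul signs, and the surplus one squares to `1`. -/
theorem immTerm_comp_perm {m n r : ℕ} (I : Fin r → Fin (m + n)) (σ τ : Equiv.Perm (Fin r)) :
    immTerm (I ∘ τ) σ = immTerm I (τ * σ * τ⁻¹) := by
  set σ' := τ * σ * τ⁻¹ with hσ
  have e : τ * σ = σ' * τ := by rw [hσ]; group
  have h1 : (I ∘ τ) ∘ σ = (I ∘ σ') ∘ τ := by
    rw [Function.comp_assoc, Function.comp_assoc, ← Equiv.Perm.coe_mul, e, Equiv.Perm.coe_mul]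
  have h2 := koszul_mul (parities I) τ σ
  rw [e, koszul_mul] at h2
  change _ * koszul (parities (I ∘ σ')) τ = _ * koszul (parities (I ∘ τ)) σ at h2
  rw [immTerm, immTerm, sum_parities_comp_perm, h1, coeff_comp_perm, smul_smul]
  congr 1
  have h3 := koszul_mul_self (parities I) τ
  have h4 := koszul_mul_self (parities (I ∘ σ')) τ
  calc _ = (-1 : ℂ) ^ (∑ a, parities I a) * koszul (parities (I ∘ σ')) τ *
        (koszul (parities I) τ * koszul (parities (I ∘ τ)) σ) := by ring
    _ = (-1 : ℂ) ^ (∑ a, parities I a) * koszul (parities I) σ' *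
        (koszul (parities (I ∘ σ')) τ * koszul (parities (I ∘ σ')) τ) := by rw [← h2]; ring
    _ = _ := by rw [h4, mul_one]

theorem superImmanant_comp_perm {m n r : ℕ} (χ : Equiv.Perm (Fin r) → ℂ)
    (I : Fin r → Fin (m + n)) (τ : Equiv.Perm (Fin r)) :
    superImmanant m n χ (I ∘ τ) (I ∘ τ) =
      superImmanant m n (fun σ => χ (τ⁻¹ * σ * τ)) I I := by
  rw [superImmanant_eq_sum, superImmanant_eq_sum]
  refine Fintype.sum_equiv (MulAut.conj τ).toEquiv _ _ fun σ => ?_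
  rw [immTerm_comp_perm]
  simp [MulAut.conj_apply, mul_assoc]

/-! ### Decomposition into blocks -/

theorem finSigmaFinEquiv_lt_iff {l : ℕ} {lam : Fin l → ℕ} (j : Fin l) (a b : Fin (lam j)) :
    finSigmaFinEquiv ⟨j, a⟩ < (finSigmaFinEquiv ⟨j, b⟩ : Fin (∑ i, lam i)) ↔ a < b := by
  rw [Fin.lt_def, finSigmaFinEquiv_apply, finSigmaFinEquiv_apply, Fin.lt_def]
  simp

theorem finSigmaFinEquiv_lt_of_lt {l : ℕ} {lam : Fin l → ℕ} {j j' : Fin l} (h : j < j')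
    (a : Fin (lam j)) (b : Fin (lam j')) :
    finSigmaFinEquiv ⟨j, a⟩ < (finSigmaFinEquiv ⟨j', b⟩ : Fin (∑ i, lam i)) := by
  rw [Fin.lt_def, finSigmaFinEquiv_apply, finSigmaFinEquiv_apply]
  set f : ℕ → ℕ := fun i => if h : i < l then lam ⟨i, h⟩ else 0 with hf
  have hs : ∀ j : Fin l, ∑ i : Fin j, lam (Fin.castLE j.2.le i) = ∑ i ∈ Finset.range j, f i := by
    intro j
    rw [Finset.sum_range]
    refine Finset.sum_congr rfl fun i _ => ?_
    have : (i : ℕ) < l := i.2.trans j.2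
    simp only [hf, this, dif_pos]
    rfl
  have h1 : f j = lam j := by simp [hf]
  have h2 : ∑ i ∈ Finset.range (j + 1), f i ≤ ∑ i ∈ Finset.range j', f i :=
    Finset.sum_le_sum_of_subset (Finset.range_subset_range.2 h)
  rw [Finset.sum_range_succ, h1] at h2
  simp only [hs]
  have := a.2
  omega

/-- The condition across blocks concerns only the product over a whole later block: for `coeffSign`
the individual cross factors can be `-1`. -/
theorem pairProd_sigma {M : Type*} [CommMonoid M] {l : ℕ} {lam : Fin l → ℕ}
    (h : Fin (∑ j, lam j) → Fin (∑ j, lam j) → M)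
    (hc : ∀ j j' (a : Fin (lam j)), j < j' →
      ∏ b : Fin (lam j'), h (finSigmaFinEquiv ⟨j, a⟩) (finSigmaFinEquiv ⟨j', b⟩) = 1) :
    pairProd h =
      ∏ j, pairProd fun a b => h (finSigmaFinEquiv ⟨j, a⟩) (finSigmaFinEquiv ⟨j, b⟩) := by
  rw [pairProd, ← finSigmaFinEquiv.prod_comp, Fintype.prod_sigma]
  refine Finset.prod_congr rfl fun j _ => Finset.prod_congr rfl fun a _ => ?_
  rw [← finSigmaFinEquiv.prod_comp, Fintype.prod_sigma, Finset.prod_eq_single j]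
  · simp only [finSigmaFinEquiv_lt_iff]
  · intro j' _ hj
    rcases lt_or_gt_of_ne hj with hj | hj
    · refine Finset.prod_eq_one fun b _ => if_neg ?_
      exact (finSigmaFinEquiv_lt_of_lt hj b a).not_gt
    · simp only [finSigmaFinEquiv_lt_of_lt hj, if_true]
      exact hc j j' a hj
  · simp

/-- Order matters in a noncommutative monoid. The concatenated blocks and `List.finRange` are
strictly increasing lists with the same members, so they are equal. -/
theorem prod_ofFn_sigma {M : Type*} [Monoid M] {l : ℕ} {lam : Fin l → ℕ}
    (y : Fin (∑ j, lam j) → M) :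
    (List.ofFn y).prod =
      (List.ofFn fun j => (List.ofFn fun a => y (finSigmaFinEquiv ⟨j, a⟩)).prod).prod := by
  have h : List.finRange (∑ j, lam j) = (List.ofFn fun j => List.ofFn fun a : Fin (lam j) =>
      (finSigmaFinEquiv ⟨j, a⟩ : Fin (∑ j, lam j))).flatten := by
    have hp : ((List.ofFn fun j => List.ofFn fun a : Fin (lam j) =>
        (finSigmaFinEquiv ⟨j, a⟩ : Fin (∑ j, lam j))).flatten).Pairwise (· < ·) := by
      rw [List.pairwise_flatten]
      constructor
      · intro L hL
        rw [List.mem_ofFn] at hL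
        obtain ⟨j, rfl⟩ := hL
        rw [List.pairwise_ofFn]
        intro a b hab
        exact (finSigmaFinEquiv_lt_iff j a b).2 hab
      · rw [List.pairwise_ofFn]
        intro j j' hj x hx x' hx'
        rw [List.mem_ofFn] at hx hx'
        obtain ⟨a, rfl⟩ := hx
        obtain ⟨b, rfl⟩ := hx'
        exact finSigmaFinEquiv_lt_of_lt hj a b
    refine List.Perm.eq_of_pairwise (le := (· < ·)) (fun a b _ _ h1 h2 => (lt_asymm h1 h2).elim)
      (List.pairwise_lt_finRange _) hp ?_
    rw [List.perm_ext_iff_of_nodup (List.nodup_finRange _) (hp.imp fun h => h.ne)]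
    intro x
    simp only [List.mem_finRange, true_iff, List.mem_flatten, List.mem_ofFn]
    obtain ⟨⟨j, a⟩, rfl⟩ := finSigmaFinEquiv.surjective x
    exact ⟨_, ⟨j, rfl⟩, List.mem_ofFn.2 ⟨a, rfl⟩⟩
  rw [List.ofFn_eq_map, h, List.map_flatten, List.prod_flatten, List.map_map, List.map_ofFn]
  congr 2
  funext j
  simp [List.map_ofFn, Function.comp_def]

theorem prod_ofFn_smul {A : Type*} [Ring A] [Algebra ℂ A] {l : ℕ} (c : Fin l → ℂ)
    (y : Fin l → A) :
    (List.ofFn fun j => c j • y j).prod = (∏ j, c j) • (List.ofFn y).prod := by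
  induction l with
  | zero => simp
  | succ l ih =>
    rw [List.ofFn_succ, List.prod_cons, ih (fun j => c j.succ) (fun j => y j.succ),
      List.ofFn_succ, List.prod_cons, Fin.prod_univ_succ, smul_mul_smul_comm]

theorem prod_ofFn_smul_coord {m n l : ℕ} (c : Fin l → ℂ) (y : Fin l → Coord m n) :
    (List.ofFn fun j => c j • y j).prod = (∏ j, c j) • (List.ofFn y).prod :=
  prod_ofFn_smul c y

/-- Distributivity for ordered products in a noncommutative ring. -/
theorem prod_ofFn_sum {A : Type*} [Semiring A] {l : ℕ} {S : Fin l → Type*}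
    [∀ j, Fintype (S j)] (f : ∀ j, S j → A) :
    (List.ofFn fun j => ∑ s, f j s).prod = ∑ g : ∀ j, S j, (List.ofFn fun j => f j (g j)).prod := by
  induction l with
  | zero => simp
  | succ l ih =>
    rw [List.ofFn_succ, List.prod_cons, ih (fun j => f j.succ), Finset.sum_mul_sum,
      ← Fintype.sum_prod_type' (f := fun s (g : ∀ j : Fin l, S j.succ) =>
        f 0 s * (List.ofFn fun j => f j.succ (g j)).prod)]
    refine Fintype.sum_equiv (Fin.consEquiv S) _ _ fun x => ?_
    rw [List.ofFn_succ, List.prod_cons]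
    simp [Fin.consEquiv]

/-- The permutation of the concatenation of the blocks that permutes every block. -/
def glue {l : ℕ} {lam : Fin l → ℕ} (g : ∀ j, Equiv.Perm (Fin (lam j))) :
    Equiv.Perm (Fin (∑ j, lam j)) :=
  finSigmaFinEquiv.permCongr (Equiv.Perm.sigmaCongrRight g)

@[simp]
theorem glue_apply {l : ℕ} {lam : Fin l → ℕ} (g : ∀ j, Equiv.Perm (Fin (lam j))) (j : Fin l)
    (a : Fin (lam j)) :
    glue g (finSigmaFinEquiv ⟨j, a⟩) = finSigmaFinEquiv ⟨j, g j a⟩ := by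
  simp [glue, Equiv.permCongr_apply]

/-- The restriction of a tuple to a block. -/
def block {α : Type*} {l : ℕ} {lam : Fin l → ℕ} (I : Fin (∑ j, lam j) → α) (j : Fin l) :
    Fin (lam j) → α :=
  fun a => I (finSigmaFinEquiv ⟨j, a⟩)

theorem block_comp_glue {α : Type*} {l : ℕ} {lam : Fin l → ℕ} (I : Fin (∑ j, lam j) → α)
    (g : ∀ j, Equiv.Perm (Fin (lam j))) (j : Fin l) :
    block (I ∘ glue g) j = block I j ∘ g j := by
  funext a
  simp [block]

theorem koszul_glue {l : ℕ} {lam : Fin l → ℕ} (p : Fin (∑ j, lam j) → ℕ)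
    (g : ∀ j, Equiv.Perm (Fin (lam j))) :
    koszul p (glue g) = ∏ j, koszul (block p j) (g j) := by
  rw [koszul, pairProd_sigma]
  · refine Finset.prod_congr rfl fun j _ => ?_
    simp only [glue_apply, finSigmaFinEquiv_lt_iff]
    rfl
  · intro j j' a hj
    refine Finset.prod_eq_one fun b _ => if_neg ?_
    rw [glue_apply, glue_apply]
    exact (finSigmaFinEquiv_lt_of_lt hj _ _).not_gt

/-- Permuting inside a later block preserves its total parity, so the entries of that block together
have even parity and the cross signs vanish. -/
theorem coeff_glue {m n l : ℕ} {lam : Fin l → ℕ} (I : Fin (∑ j, lam j) → Fin (m + n))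
    (g : ∀ j, Equiv.Perm (Fin (lam j))) :
    coeff (I ∘ glue g) I = (List.ofFn fun j => coeff (block I j ∘ g j) (block I j)).prod := by
  simp only [coeff]
  rw [prod_ofFn_smul_coord, prod_ofFn_sigma, coeffSign, pairProd_sigma]
  · simp only [parities, Function.comp_apply, glue_apply, genEntries]
    rfl
  · intro j j' a _
    rw [Finset.prod_pow_eq_pow_sum, ← Finset.mul_sum]
    refine Even.neg_one_pow (Even.mul_left ?_ _)
    rw [Finset.sum_add_distrib]
    have h1 := sum_parities_comp_perm (block I j') (g j')
    rw [← block_comp_glue] at h1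
    exact ⟨∑ b, parities (block I j') b, congrArg (· + ∑ b, parities (block I j') b) h1⟩

theorem immTerm_glue {m n l : ℕ} {lam : Fin l → ℕ} (I : Fin (∑ j, lam j) → Fin (m + n))
    (g : ∀ j, Equiv.Perm (Fin (lam j))) :
    immTerm I (glue g) = (List.ofFn fun j => immTerm (block I j) (g j)).prod := by
  simp only [immTerm]
  rw [prod_ofFn_smul_coord, koszul_glue, coeff_glue, Finset.prod_mul_distrib,
    Finset.prod_pow_eq_pow_sum]
  congr 3
  rw [← finSigmaFinEquiv.sum_comp, Fintype.sum_sigma]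
  rfl

theorem glue_injective {l : ℕ} {lam : Fin l → ℕ} :
    Function.Injective (glue : (∀ j, Equiv.Perm (Fin (lam j))) → _) :=
  (Equiv.injective _).comp Equiv.Perm.sigmaCongrRightHom_injective

theorem glue_mem_youngSubgroup {l : ℕ} {lam : Fin l → ℕ} (g : ∀ j, Equiv.Perm (Fin (lam j))) :
    glue g ∈ youngSubgroup lam rfl := by
  intro i
  obtain ⟨⟨j, a⟩, rfl⟩ := finSigmaFinEquiv.surjective i
  rw [glue_apply]
  simp [blockIndex]

theorem exists_glue_eq {l : ℕ} {lam : Fin l → ℕ} {σ : Equiv.Perm (Fin (∑ j, lam j))}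
    (hσ : σ ∈ youngSubgroup lam rfl) : ∃ g, glue g = σ := by
  have h : ∀ x : Σ j, Fin (lam j), (finSigmaFinEquiv.symm (σ (finSigmaFinEquiv x))).1 = x.1 := by
    intro x
    have := hσ (finSigmaFinEquiv x)
    simpa [blockIndex] using this
  have hg : ∀ j (a : Fin (lam j)), ∃ b : Fin (lam j),
      σ (finSigmaFinEquiv ⟨j, a⟩) = finSigmaFinEquiv ⟨j, b⟩ := by
    intro j a
    have h1 := h ⟨j, a⟩
    obtain ⟨⟨j', b⟩, hb⟩ := finSigmaFinEquiv.surjective (σ (finSigmaFinEquiv ⟨j, a⟩))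
    rw [← hb, Equiv.symm_apply_apply] at h1
    obtain rfl : j' = j := h1
    exact ⟨b, hb.symm⟩
  choose g hg using hg
  have hinj : ∀ j, Function.Injective (g j) := by
    intro j a b hab
    have h1 : σ (finSigmaFinEquiv ⟨j, a⟩) = σ (finSigmaFinEquiv ⟨j, b⟩) := by rw [hg, hg, hab]
    simpa using h1
  refine ⟨fun j => Equiv.ofBijective (g j) (Finite.injective_iff_bijective.1 (hinj j)), ?_⟩
  ext1 i
  obtain ⟨⟨j, a⟩, rfl⟩ := finSigmaFinEquiv.surjective i
  rw [glue_apply, hg]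
  rfl

/-- The Young subgroup is the product of the symmetric groups of the blocks. -/
def youngEquiv {l : ℕ} (lam : Fin l → ℕ) :
    (∀ j, Equiv.Perm (Fin (lam j))) ≃ youngSubgroup lam rfl :=
  Equiv.ofBijective (fun g => ⟨glue g, glue_mem_youngSubgroup g⟩)
    ⟨fun _ _ h => glue_injective (congrArg Subtype.val h),
      fun σ => (exists_glue_eq σ.2).imp fun _ h => Subtype.ext h⟩

/-! ### Characters of coinvariants and of induced representations -/

section Coinvariants

variable {H V : Type*} [Group H] [Fintype H] [AddCommGroup V] [Module ℂ V]

/-- The averaging operator of a representation of a finite group. -/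
def average (ρ : Representation ℂ H V) : V →ₗ[ℂ] V := (Fintype.card H : ℂ)⁻¹ • ∑ h, ρ h

theorem average_comp (ρ : Representation ℂ H V) (x : H) : average ρ ∘ₗ ρ x = average ρ := by
  rw [average, LinearMap.smul_comp]
  congr 1
  change (∑ h, ρ h : Module.End ℂ V) * ρ x = _
  rw [Finset.sum_mul]
  refine Fintype.sum_equiv (Equiv.mulRight x) _ _ fun h => ?_
  rw [Equiv.coe_mulRight, map_mul]

/-- The trace on the coinvariants is the average of the traces on the whole space. -/
theorem trace_coinvariants_map [FiniteDimensional ℂ V] (ρ : Representation ℂ H V)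
    (f : Representation.IntertwiningMap ρ ρ) :
    LinearMap.trace ℂ _ (Representation.Coinvariants.map ρ ρ f) =
      (Fintype.card H : ℂ)⁻¹ * ∑ h, LinearMap.trace ℂ V (f.toLinearMap ∘ₗ ρ h) := by
  have : Module.Finite ℂ ρ.Coinvariants :=
    Module.Finite.of_surjective _ (Representation.Coinvariants.mk_surjective ρ)
  -- Averaging descends to a section of the projection onto coinvariants; cyclicity of the trace
  -- then moves the computation to `V`.
  set s := Representation.Coinvariants.lift ρ (average ρ) (average_comp ρ) with hs
  have h1 : Representation.Coinvariants.mk ρ ∘ₗ s = LinearMap.id := by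
    refine Representation.Coinvariants.hom_ext (LinearMap.ext fun v => ?_)
    have hc : (Fintype.card H : ℂ) ≠ 0 := Nat.cast_ne_zero.2 Fintype.card_ne_zero
    simp only [hs, LinearMap.comp_apply, Representation.Coinvariants.lift_mk, average,
      LinearMap.smul_apply, LinearMap.sum_apply, map_smul, map_sum,
      Representation.Coinvariants.mk_self_apply, Finset.sum_const, Finset.card_univ,
      LinearMap.id_apply]
    rw [← Nat.cast_smul_eq_nsmul ℂ, smul_smul, inv_mul_cancel₀ hc, one_smul]
  have h2 : Representation.Coinvariants.map ρ ρ f =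
      Representation.Coinvariants.mk ρ ∘ₗ (f.toLinearMap ∘ₗ s) := by
    calc _ = Representation.Coinvariants.map ρ ρ f ∘ₗ
          (Representation.Coinvariants.mk ρ ∘ₗ s) := by rw [h1, LinearMap.comp_id]
      _ = _ := rfl
  rw [h2, LinearMap.trace_comp_comm']
  change LinearMap.trace ℂ V (f.toLinearMap ∘ₗ average ρ) = _
  rw [average, LinearMap.comp_smul, map_smul, smul_eq_mul]
  congr 1
  change LinearMap.trace ℂ V ((f.toLinearMap : Module.End ℂ V) * ∑ h, ρ h) = _
  rw [Finset.mul_sum, map_sum]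
  rfl

end Coinvariants

theorem trace_translate {G : Type*} [Group G] [Fintype G] [DecidableEq G]
    (f : MonoidAlgebra ℂ G →ₗ[ℂ] MonoidAlgebra ℂ G) (t : G → G)
    (hf : ∀ x, f (MonoidAlgebra.single x 1) = MonoidAlgebra.single (t x) 1) :
    LinearMap.trace ℂ _ f = ∑ x, if t x = x then 1 else 0 := by
  rw [LinearMap.trace_eq_matrix_trace ℂ (MonoidAlgebra.basis G ℂ), Matrix.trace]
  refine Finset.sum_congr rfl fun x _ => ?_
  rw [Matrix.diag_apply, LinearMap.toMatrix_apply]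
  have h : MonoidAlgebra.basis G ℂ x = MonoidAlgebra.single x 1 := by simp
  rw [h, hf]
  simp [MonoidAlgebra.basis, Finsupp.single_apply]

open Classical in
/-- The character of a representation induced from a subgroup of a finite group. -/
theorem character_ind {G A : Type*} [Group G] [Fintype G] [AddCommGroup A] [Module ℂ A]
    [FiniteDimensional ℂ A] (H : Subgroup G) (ρ : Representation ℂ H A) (g : G) :
    (Representation.ind H.subtype ρ).character g =
      (Fintype.card H : ℂ)⁻¹ * ∑ h : H, ∑ x : G,
        if (h : G) = x * g * x⁻¹ then ρ.character h else 0 := by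
  have : FiniteDimensional ℂ (MonoidAlgebra ℂ G) :=
    Module.Finite.of_basis (MonoidAlgebra.basis G ℂ)
  rw [Representation.character, Representation.ind_apply, trace_coinvariants_map]
  congr 1
  refine Finset.sum_congr rfl fun h _ => ?_
  -- The induced module is the space of `H`-coinvariants of `ℂ[G] ⊗ A`, with `g` acting by `x ↦ x
  -- g⁻¹`. The trace factors over the tensor product, and on `ℂ[G]` it counts the fixed points of `x
  -- ↦ h x g⁻¹`.
  change LinearMap.trace ℂ _ ((MonoidAlgebra.mapDomainLinearMap ℂ ℂ fun x => x * g⁻¹).rTensor A ∘ₗ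
    TensorProduct.map (Representation.leftRegular ℂ G (h : G)) (ρ h)) = _
  rw [LinearMap.rTensor, ← TensorProduct.map_comp, LinearMap.trace_tensorProduct',
    trace_translate _ (fun x => h * x * g⁻¹), LinearMap.id_comp, Finset.sum_mul]
  · refine Finset.sum_congr rfl fun x _ => ?_
    have : (h : G) * x * g⁻¹ = x ↔ (h : G) = x * g * x⁻¹ := by
      rw [mul_inv_eq_iff_eq_mul, eq_mul_inv_iff_mul_eq]
    simp only [this, ite_mul, one_mul, zero_mul]
    rfl
  · intro x
    simp

/-! ### The one-dimensional characters of the symmetric group -/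

/-- The sign character with complex values. -/
def signChar (r : ℕ) : Equiv.Perm (Fin r) →* ℂ :=
  ((Int.castRingHom ℂ : ℤ →* ℂ).comp (Units.coeHom ℤ)).comp Equiv.Perm.sign

theorem signChar_apply {r : ℕ} (σ : Equiv.Perm (Fin r)) :
    signChar r σ = ((Equiv.Perm.sign σ : ℤ) : ℂ) :=
  rfl

theorem signChar_mul_self {r : ℕ} (σ : Equiv.Perm (Fin r)) :
    signChar r σ * signChar r σ = 1 := by
  rw [signChar_apply, ← Int.cast_mul, ← Units.val_mul, Int.units_mul_self]
  simp

/-- The sum `∑ ζ(σ) σ` in the group algebra. -/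
def charSum {G : Type*} [Group G] [Fintype G] (ζ : G → ℂ) : MonoidAlgebra ℂ G :=
  ∑ σ, MonoidAlgebra.single σ (ζ σ)

/-- Left translation by `g` reindexes the sum and produces `ζ g⁻¹`, which equals `ζ g` because `ζ`
takes values `±1`. Hence the left ideal is a line. -/
theorem mul_charSum {G : Type*} [Group G] [Fintype G] (ζ : G →* ℂ) (hζ : ∀ g, ζ g * ζ g = 1)
    (a : MonoidAlgebra ℂ G) : ∃ c : ℂ, a * charSum ζ = c • charSum ζ := by
  induction a using MonoidAlgebra.induction_linear with
  | zero => exact ⟨0, by simp⟩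
  | add a b ha hb =>
    obtain ⟨c, hc⟩ := ha
    obtain ⟨d, hd⟩ := hb
    exact ⟨c + d, by rw [add_mul, hc, hd, add_smul]⟩
  | single g z =>
    refine ⟨z * ζ g, ?_⟩
    rw [charSum, Finset.mul_sum, Finset.smul_sum]
    refine Fintype.sum_equiv (Equiv.mulLeft g) _ _ fun σ => ?_
    rw [MonoidAlgebra.single_mul_single, Equiv.coe_mulLeft, map_mul, MonoidAlgebra.smul_single,
      smul_eq_mul, mul_assoc z, ← mul_assoc (ζ g), hζ, one_mul]

theorem single_mul_charSum {G : Type*} [Group G] [Fintype G] (ζ : G →* ℂ)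
    (hζ : ∀ g, ζ g * ζ g = 1) (g : G) :
    MonoidAlgebra.single g 1 * charSum ζ = ζ g • charSum ζ := by
  rw [charSum, Finset.mul_sum, Finset.smul_sum]
  refine Fintype.sum_equiv (Equiv.mulLeft g) _ _ fun σ => ?_
  rw [MonoidAlgebra.single_mul_single, Equiv.coe_mulLeft, map_mul, MonoidAlgebra.smul_single,
    smul_eq_mul, ← mul_assoc, hζ]

theorem charSum_ne_zero {G : Type*} [Group G] [Fintype G] (ζ : G →* ℂ) : charSum ζ ≠ 0 := by
  classical
  intro h
  have h1 := congrArg (fun x : MonoidAlgebra ℂ G => x.coeff 1) h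
  simp [charSum, Finsupp.single_apply, MonoidAlgebra.coeff_sum] at h1

/-- The left ideal generated by `∑ ζ(σ) σ` affords the character `ζ`. -/
theorem character_span_charSum {G : Type*} [Group G] [Fintype G] (ζ : G →* ℂ)
    (hζ : ∀ g, ζ g * ζ g = 1) (x : MonoidAlgebra ℂ G) (hx : x = charSum ζ) (g : G) :
    (Representation.ofModule' (k := ℂ) (G := G)
      (Ideal.span {x} : Ideal (MonoidAlgebra ℂ G))).character g = ζ g := by
  subst hx
  set M : Ideal (MonoidAlgebra ℂ G) := Ideal.span {charSum ζ}
  have hM : ∀ y : M, ∃ c : ℂ, (y : MonoidAlgebra ℂ G) = c • charSum ζ := by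
    rintro ⟨y, hy⟩
    obtain ⟨a, rfl⟩ := Ideal.mem_span_singleton'.1 hy
    exact mul_charSum ζ hζ a
  have hfin : Module.finrank ℂ M = 1 := by
    refine finrank_eq_one ⟨charSum ζ, Ideal.subset_span rfl⟩ ?_ ?_
    · intro h
      exact charSum_ne_zero ζ (congrArg Subtype.val h)
    · intro y
      obtain ⟨c, hc⟩ := hM y
      exact ⟨c, Subtype.ext hc.symm⟩
  have hact : Representation.ofModule' (k := ℂ) (G := G) M g = ζ g • LinearMap.id := by
    refine LinearMap.ext fun y => Subtype.ext ?_
    obtain ⟨c, hc⟩ := hM y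
    change MonoidAlgebra.single g 1 * (y : MonoidAlgebra ℂ G) = ζ g • (y : MonoidAlgebra ℂ G)
    rw [hc, mul_smul_comm, single_mul_charSum ζ hζ, smul_comm]
  rw [Representation.character, hact, map_smul, LinearMap.trace_id, hfin]
  simp

theorem cellAt_replicate {r i : ℕ} (h : i < r) : cellAt (List.replicate r 1) i = (i, 0) := by
  induction r generalizing i with
  | zero => omega
  | succ r ih =>
    rw [List.replicate_succ, cellAt]
    rcases i with _ | i
    · simp
    · simp [ih (Nat.lt_of_succ_lt_succ h)]

theorem tableauCell_colPartition {r : ℕ} (i : Fin r) :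
    tableauCell (colPartition r) i = (↑i, 0) := by
  have h : (colPartition r).parts = Multiset.replicate r 1 := by
    rw [colPartition, Nat.Partition.ofSums_parts, Multiset.filter_eq_self]
    intro a ha
    rw [Multiset.eq_of_mem_replicate ha]
    exact one_ne_zero
  have h2 : ((colPartition r).parts.sort (· ≥ ·)) = List.replicate r 1 := by
    rw [List.eq_replicate_iff, Multiset.length_sort, h, Multiset.card_replicate]
    exact ⟨rfl, fun b hb => Multiset.eq_of_mem_replicate (Multiset.mem_sort _ |>.1 hb)⟩
  rw [tableauCell, h2, cellAt_replicate i.2]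

theorem tableauCell_rowPartition {r : ℕ} (i : Fin r) :
    tableauCell (rowPartition r) i = (0, ↑i) := by
  -- The one-row partition of `0` has no parts, so this case is excluded first.
  have hr : r ≠ 0 := by
    rintro rfl
    exact i.elim0
  rw [tableauCell, rowPartition, Nat.Partition.indiscrete_parts hr, Multiset.sort_singleton,
    cellAt, if_pos i.2]

theorem filter_forall_apply_eq {r : ℕ} :
    Finset.univ.filter (fun σ : Equiv.Perm (Fin r) => ∀ i, ((σ i : Fin r) : ℕ) = i) = {1} := by
  ext σ
  simp only [Finset.mem_filter, Finset.mem_univ, true_and, Finset.mem_singleton, Equiv.ext_iff,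
    Fin.ext_iff, Equiv.Perm.one_apply]

/-- In a single column only the identity preserves rows and every permutation preserves columns, so
the Young symmetrizer is the signed sum over the group. -/
theorem irrChar_colPartition (r : ℕ) : irrChar (colPartition r) = signChar r := by
  funext g
  refine character_span_charSum (signChar r) signChar_mul_self _ ?_ g
  simp only [youngSymmetrizer, tableauCell_colPartition, filter_forall_apply_eq, implies_true,
    Finset.filter_true, Finset.sum_singleton]
  rw [← MonoidAlgebra.one_def, one_mul]
  rfl

theorem irrChar_rowPartition (r : ℕ) :
    irrChar (rowPartition r) = (1 : Equiv.Perm (Fin r) →* ℂ) := by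
  funext g
  refine character_span_charSum (1 : Equiv.Perm (Fin r) →* ℂ) (fun _ => by simp) _ ?_ g
  simp only [youngSymmetrizer, tableauCell_rowPartition, filter_forall_apply_eq, implies_true,
    Finset.filter_true, Finset.sum_singleton, map_one, Units.val_one, Int.cast_one]
  rw [← MonoidAlgebra.one_def, mul_one]
  rfl

/-! ### Super-immanants of induced characters -/

/-- The super-immanant of a function induced from the Young subgroup is a sum over all
rearrangements of products of super-immanants of the blocks. -/
theorem superImmanant_induced {m n l : ℕ} {lam : Fin l → ℕ} (I : Fin (∑ j, lam j) → Fin (m + n))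
    (χ ζ : Equiv.Perm (Fin (∑ j, lam j)) → ℂ) (ζ' : ∀ j, Equiv.Perm (Fin (lam j)) → ℂ)
    (hζ : ∀ g, ζ (glue g) = ∏ j, ζ' j (g j))
    [Fintype (youngSubgroup lam rfl)]
    (hχ : ∀ σ, χ σ = (Fintype.card (youngSubgroup lam rfl) : ℂ)⁻¹ *
      ∑ h : youngSubgroup lam rfl, ∑ x : Equiv.Perm (Fin (∑ j, lam j)),
        if (h : Equiv.Perm (Fin (∑ j, lam j))) = x * σ * x⁻¹ then ζ h else 0) :
    superImmanant m n χ I I = (Fintype.card (∀ j, Equiv.Perm (Fin (lam j))) : ℂ)⁻¹ •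
      ∑ x : Equiv.Perm (Fin (∑ j, lam j)), (List.ofFn fun j =>
        superImmanant m n (ζ' j) (block (I ∘ x) j) (block (I ∘ x) j)).prod := by
  have hcard : Fintype.card (youngSubgroup lam rfl) =
      Fintype.card (∀ j, Equiv.Perm (Fin (lam j))) := Fintype.card_congr (youngEquiv lam).symm
  rw [superImmanant_eq_sum]
  simp only [hχ, mul_smul, hcard]
  rw [← Finset.smul_sum]
  congr 1
  -- Distributivity expands the product over tuples of block permutations, that is, over the Young
  -- subgroup; conjugation by `x` then returns from `I ∘ x` to `I`.
  have h1 : ∀ x : Equiv.Perm (Fin (∑ j, lam j)), (List.ofFn fun j =>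
      superImmanant m n (ζ' j) (block (I ∘ x) j) (block (I ∘ x) j)).prod =
      ∑ h : youngSubgroup lam rfl, ζ h • immTerm I (x * h * x⁻¹) := by
    intro x
    simp only [superImmanant_eq_sum]
    rw [prod_ofFn_sum, ← (youngEquiv lam).sum_comp]
    refine Finset.sum_congr rfl fun g _ => ?_
    change _ = ζ (glue g) • immTerm I (x * glue g * x⁻¹)
    rw [prod_ofFn_smul_coord, ← immTerm_glue, hζ, immTerm_comp_perm]
  simp only [h1, Finset.sum_smul]
  rw [Finset.sum_comm]
  conv_rhs => rw [Finset.sum_comm]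
  refine Finset.sum_congr rfl fun h _ => ?_
  -- After `x` is replaced by `x⁻¹`, the induction condition selects the single `σ = x h x⁻¹`.
  rw [Finset.sum_comm, ← Equiv.sum_comp (Equiv.inv (Equiv.Perm (Fin (∑ j, lam j))))]
  refine Finset.sum_congr rfl fun x _ => ?_
  rw [Finset.sum_eq_single (x * h * x⁻¹)]
  · simp [mul_assoc]
  · intro σ _ hσ
    rw [if_neg, zero_smul]
    rintro e
    apply hσ
    rw [e]
    simp [mul_assoc]
  · simp

/-! ### Counting rearrangements -/

theorem entries_eq_sum {m n r : ℕ} (I : Fin r → Fin (m + n)) : entries I = ∑ a, {I a} := by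
  have h := Multiset.map_map (fun i => ({i} : Multiset (Fin (m + n)))) I Finset.univ.val
  rw [Finset.sum, entries, ← Multiset.sum_map_singleton (Multiset.map I _), h]
  rfl

theorem entries_comp_perm {m n r : ℕ} (I : Fin r → Fin (m + n)) (σ : Equiv.Perm (Fin r)) :
    entries (I ∘ σ) = entries I := by
  rw [entries_eq_sum, entries_eq_sum]
  exact Equiv.sum_comp σ fun a => ({I a} : Multiset (Fin (m + n)))

theorem sum_entries_block {m n l : ℕ} {lam : Fin l → ℕ} (I : Fin (∑ j, lam j) → Fin (m + n)) :
    ∑ j, entries (block I j) = entries I := by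
  simp only [entries_eq_sum]
  rw [← finSigmaFinEquiv.sum_comp, Fintype.sum_sigma]
  rfl

theorem exists_eq_comp_perm {m n r : ℕ} {I J : Fin r → Fin (m + n)} (h : entries I = entries J) :
    ∃ τ : Equiv.Perm (Fin r), J = I ∘ τ := by
  have h1 : I ∘ Tuple.sort I = J ∘ Tuple.sort J := by
    refine List.ofFn_injective (List.Perm.eq_of_pairwise (le := (· ≤ ·))
      (fun a b _ _ => le_antisymm) ?_ ?_ ?_)
    · exact List.pairwise_ofFn.2 fun a b hab => Tuple.monotone_sort I hab.le
    · exact List.pairwise_ofFn.2 fun a b hab => Tuple.monotone_sort J hab.le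
    · rw [← Multiset.coe_eq_coe, ← Fin.univ_val_map, ← Fin.univ_val_map]
      exact ((entries_comp_perm I _).trans h).trans (entries_comp_perm J _).symm
  refine ⟨Tuple.sort I * (Tuple.sort J)⁻¹, ?_⟩
  rw [Equiv.Perm.coe_mul, ← Function.comp_assoc, h1, Function.comp_assoc, ← Equiv.Perm.coe_mul,
    mul_inv_cancel]
  rfl

/-- The solutions form a translate of the stabilizer of `I`, which permutes each fibre of `I`
freely. -/
theorem card_comp_eq {m n r : ℕ} {I J : Fin r → Fin (m + n)} (h : entries I = entries J) :
    (Finset.univ.filter fun σ : Equiv.Perm (Fin r) => I ∘ σ = J).card = alphaFactorial I := by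
  obtain ⟨τ, rfl⟩ := exists_eq_comp_perm h
  have h1 : (Finset.univ.filter fun σ : Equiv.Perm (Fin r) => I ∘ σ = I ∘ τ).card =
      (Finset.univ.filter fun σ : Equiv.Perm (Fin r) => I ∘ σ = I).card := by
    refine Finset.card_equiv (Equiv.mulRight τ⁻¹) fun σ => ?_
    simp only [Finset.mem_filter, Finset.mem_univ, true_and, Equiv.coe_mulRight,
      Equiv.Perm.coe_mul, ← Function.comp_assoc]
    constructor
    · intro e
      rw [e, Function.comp_assoc, ← Equiv.Perm.coe_mul, mul_inv_cancel]
      rfl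
    · intro e
      conv_rhs => rw [← e, Function.comp_assoc, ← Equiv.Perm.coe_mul, inv_mul_cancel]
      rfl
  rw [h1, ← Fintype.card_subtype, DomMulAct.stabilizer_card, alphaFactorial]
  refine Finset.prod_congr rfl fun i _ => ?_
  congr 1
  rw [entries, Multiset.count_map, Fintype.card_subtype]
  simp only [eq_comm (a := i)]
  rfl

theorem alphaFactorial_ne_zero {m n r : ℕ} (I : Fin r → Fin (m + n)) :
    (alphaFactorial I : ℂ) ≠ 0 :=
  Nat.cast_ne_zero.2 (Finset.prod_ne_zero_iff.2 fun _ _ => Nat.factorial_ne_zero _)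

theorem card_block_comp_eq {m n l : ℕ} {lam : Fin l → ℕ} (B D : ∀ j, Fin (lam j) → Fin (m + n))
    (h : ∀ j, entries (B j) = entries (D j)) :
    (Finset.univ.filter fun g : ∀ j, Equiv.Perm (Fin (lam j)) =>
      (fun j => B j ∘ g j) = D).card = ∏ j, alphaFactorial (D j) := by
  have h1 : (Finset.univ.filter fun g : ∀ j, Equiv.Perm (Fin (lam j)) =>
      (fun j => B j ∘ g j) = D) =
      Fintype.piFinset fun j => Finset.univ.filter fun σ : Equiv.Perm (Fin (lam j)) =>
        B j ∘ σ = D j := by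
    ext g
    simp [funext_iff (f := fun j => B j ∘ g j)]
  rw [h1, Fintype.card_piFinset]
  refine Finset.prod_congr rfl fun j _ => ?_
  rw [card_comp_eq (h j), alphaFactorial, alphaFactorial, h j]

/-- Summation over all rearrangements of `I` of a function of the blocks that does not depend on
the order inside the blocks. -/
theorem sum_perm_blocks {m n l : ℕ} {lam : Fin l → ℕ} {A : Type*} [AddCommGroup A] [Module ℂ A]
    (I : Fin (∑ j, lam j) → Fin (m + n)) (F : (∀ j, Fin (lam j) → Fin (m + n)) → A)
    (hF : ∀ D (g : ∀ j, Equiv.Perm (Fin (lam j))), F (fun j => D j ∘ g j) = F D) :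
    (Fintype.card (∀ j, Equiv.Perm (Fin (lam j))) : ℂ)⁻¹ •
      ∑ x : Equiv.Perm (Fin (∑ j, lam j)), F (block (I ∘ x)) =
      ∑ D ∈ decompositions lam I,
        ((alphaFactorial I : ℂ) / ∏ j, (alphaFactorial (D j) : ℂ)) • F D := by
  have hmem : ∀ D, D ∈ decompositions lam I ↔
      (∀ j, Monotone (D j)) ∧ ∑ j, entries (D j) = entries I := by
    intro D
    simp [decompositions]
  -- The weights form a partition of unity: only the blockwise sorted version of `I ∘ x`
  -- contributes, and it is reached by exactly `∏ α(D_j)` tuples `g`.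
  have h1 : ∀ x : Equiv.Perm (Fin (∑ j, lam j)), F (block (I ∘ x)) =
      ∑ D ∈ decompositions lam I, ((∏ j, (alphaFactorial (D j) : ℂ))⁻¹ *
        ∑ g : ∀ j, Equiv.Perm (Fin (lam j)),
          if (fun j => block (I ∘ x) j ∘ g j) = D then (1 : ℂ) else 0) • F D := by
    intro x
    set B := block (I ∘ x) with hB
    set D₀ : ∀ j, Fin (lam j) → Fin (m + n) := fun j => B j ∘ Tuple.sort (B j) with hD
    rw [Finset.sum_eq_single D₀]
    · rw [Finset.sum_boole, card_block_comp_eq B D₀ fun j => (entries_comp_perm _ _).symm,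
        Nat.cast_prod, inv_mul_cancel₀, one_smul, hD, hF B fun j => Tuple.sort (B j)]
      exact Finset.prod_ne_zero_iff.2 fun j _ => alphaFactorial_ne_zero _
    · intro D hDm hne
      rw [Finset.sum_eq_zero, mul_zero, zero_smul]
      intro g _
      rw [if_neg]
      rintro rfl
      apply hne
      funext j
      exact Tuple.comp_sort_eq_comp_iff_monotone.2 (((hmem _).1 hDm).1 j)
    · intro h
      refine (h ((hmem _).2 ⟨fun j => Tuple.monotone_sort _, ?_⟩)).elim
      simp only [hD, entries_comp_perm]
      rw [hB, sum_entries_block, entries_comp_perm]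
  simp only [h1]
  rw [Finset.sum_comm, Finset.smul_sum]
  refine Finset.sum_congr rfl fun D hDm => ?_
  rw [← Finset.sum_smul, smul_smul, ← Finset.mul_sum, Finset.sum_comm]
  congr 1
  obtain ⟨J, rfl⟩ : ∃ J, block J = D := by
    refine ⟨fun i => D (finSigmaFinEquiv.symm i).1 (finSigmaFinEquiv.symm i).2, ?_⟩
    funext j a
    simp only [block]
    rw [Equiv.symm_apply_apply]
  have hblock : ∀ J', block J' = block J ↔ J' = J := by
    intro J'
    refine ⟨fun h => funext fun i => ?_, fun h => by rw [h]⟩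
    obtain ⟨⟨j, a⟩, rfl⟩ := finSigmaFinEquiv.surjective i
    exact congrFun (congrFun h j) a
  have hJ : entries I = entries J := by
    rw [← ((hmem _).1 hDm).2, sum_entries_block]
  -- Absorbing `glue g` into `x` makes the count independent of `g`, so the sum over `g` cancels the
  -- factor `1 / ∏ λ_j!`.
  have h2 : ∀ g : ∀ j, Equiv.Perm (Fin (lam j)),
      (∑ x : Equiv.Perm (Fin (∑ j, lam j)),
        if (fun j => block (I ∘ x) j ∘ g j) = block J then (1 : ℂ) else 0) =
      alphaFactorial I := by
    intro g
    rw [← card_comp_eq hJ, ← Finset.sum_boole]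
    refine Fintype.sum_equiv (Equiv.mulRight (glue g)) _ _ fun x => ?_
    have : (fun j => block (I ∘ x) j ∘ g j) = block (I ∘ (x * glue g)) := by
      funext j
      rw [← block_comp_glue]
      rfl
    simp only [this, hblock]
    rfl
  have hc : (Fintype.card (∀ j, Equiv.Perm (Fin (lam j))) : ℂ) ≠ 0 :=
    Nat.cast_ne_zero.2 Fintype.card_ne_zero
  simp only [h2, Finset.sum_const, Finset.card_univ, nsmul_eq_mul]
  field_simp

/-! ### The formula for linear characters, and its two instances -/

theorem signChar_glue {l : ℕ} {lam : Fin l → ℕ} (g : ∀ j, Equiv.Perm (Fin (lam j))) :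
    signChar _ (glue g) = ∏ j, signChar _ (g j) := by
  simp only [signChar_apply, sign_eq_koszul]
  exact koszul_glue _ g

/-- The sign and trivial cases share one argument, needing only a family of linear characters
multiplicative under gluing. Being class functions, they make the block super-immanants independent
of the order within each block. -/
theorem superImmanant_induced_eq_sum {m n l : ℕ} {lam : Fin l → ℕ}
    (I : Fin (∑ j, lam j) → Fin (m + n)) (ζ : ∀ r, Equiv.Perm (Fin r) →* ℂ)
    (hζ : ∀ g : ∀ j, Equiv.Perm (Fin (lam j)), ζ _ (glue g) = ∏ j, ζ _ (g j))
    (ρ : Representation ℂ (youngSubgroup lam rfl) ℂ) 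
    (hρ : ∀ h, ρ h = ζ _ (h : Equiv.Perm (Fin (∑ j, lam j))) • LinearMap.id) :
    superImmanant m n (Representation.ind (youngSubgroup lam rfl).subtype ρ).character I I =
      ∑ D ∈ decompositions lam I,
        ((alphaFactorial I : ℂ) / ∏ j, (alphaFactorial (D j) : ℂ)) •
          (List.ofFn fun j => superImmanant m n (ζ (lam j)) (D j) (D j)).prod := by
  classical
  rw [superImmanant_induced I _ (ζ _) (fun j => ζ (lam j)) hζ fun σ => ?_]
  · refine sum_perm_blocks I (fun D => (List.ofFn fun j =>
      superImmanant m n (ζ (lam j)) (D j) (D j)).prod) fun D g => ?_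
    simp only
    congr 2
    funext j
    rw [superImmanant_comp_perm]
    congr 1
    funext σ
    rw [map_mul, map_mul, mul_right_comm, ← map_mul, inv_mul_cancel, map_one, one_mul]
  · rw [character_ind]
    have : ∀ h, ρ.character h = ζ _ (h : Equiv.Perm (Fin (∑ j, lam j))) := by
      intro h
      rw [Representation.character, hρ, map_smul, LinearMap.trace_id]
      simp
    simp only [this]

end SuperImm

end

theorem mainTheorem10 (m n k l : ℕ) (I : Fin k → Fin (m + n)) (hI : Monotone I)
    (lam : Fin l → ℕ) (hlam : Antitone lam) (hsum : ∑ j, lam j = k) :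
    SuperImm.superImmanant m n (SuperImm.psi lam hsum) I I =
      ∑ D ∈ SuperImm.decompositions lam I,
        ((SuperImm.alphaFactorial I : ℂ) / ∏ j, (SuperImm.alphaFactorial (D j) : ℂ)) •
          (List.ofFn fun j => SuperImm.superImmanant m n
            (SuperImm.irrChar (SuperImm.colPartition (lam j))) (D j) (D j)).prod ∧
    SuperImm.superImmanant m n (SuperImm.phi lam hsum) I I =
      ∑ D ∈ SuperImm.decompositions lam I,
        ((SuperImm.alphaFactorial I : ℂ) / ∏ j, (SuperImm.alphaFactorial (D j) : ℂ)) •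
          (List.ofFn fun j => SuperImm.superImmanant m n
            (SuperImm.irrChar (SuperImm.rowPartition (lam j))) (D j) (D j)).prod := by
  -- The positions become literally `Fin (∑ j, lam j)`, so blocks are read off `finSigmaFinEquiv`
  -- without casts.
  subst hsum
  simp only [SuperImm.irrChar_colPartition, SuperImm.irrChar_rowPartition]
  constructor
  · exact SuperImm.superImmanant_induced_eq_sum I SuperImm.signChar SuperImm.signChar_glue _
      fun _ => rfl
  · exact SuperImm.superImmanant_induced_eq_sum I (fun _ => 1) (fun _ => by simp) _
      fun _ => (one_smul ℂ _).symm
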